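/- Let $K$ be a field and let $R = K\langle x,y\rangle/(xy-1)$ be the Toeplitz--Jacobson algebra. Put $f_1 = 1-yx$ and let $S_1 = Rf_1$ be the corresponding left ideal. There is a surjection of $K$-algebras $R\to K[x,x^{-1}]$ with $x\mapsto x$, $y\mapsto x^{-1}$; for a polynomial $p\in K[x]$ let $L_p = K[x,x^{-1}]/(p)$, viewed as a left $R$-module through this surjection, and let $p^*$ be the reversed polynomial, determined by $p^*(y) = p(x)\,y^{\deg p}\in K[y]\subseteq R$. All modules are left modules. (1) For every $R$-module $M$ of finite length there are $k\in\mathbb N$ and a short exact sequence of $R$-modules $0\to S_1^{\oplus k}\to M\to F\to 0$ with $F$ finite-dimensional over $K$. (2) Every $R$-module that is finite-dimensional over $K$ is isomorphic to a finite direct sum $L_{p_1}\oplus\dots\oplus L_{p_n}$ with nonzero (not necessarily irreducible) polynomials $p_i\in K[x]$. (3) For all nonzero $p\in K[x]$ and all $k\in\mathbb N$ there is a natural isomorphism of $K$-vector spaces $$\Theta_{p,k}:\ \operatorname{Ext}^1_R(L_p, S_1^{\oplus k})\ \xrightarrow{\ \cong\ }\ \bigl(K[T]/(p^*(T))\bigr)^{\oplus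 k}.$$ Explicitly, for a tuple $g=(g_1,\dots,g_k)\in K[T]^k$ write $g(y)f_1 = (g_1(y)f_1,\dots,g_k(y)f_1)\in S_1^{\oplus k}$. The isomorphisms $\Theta_{p,k}$ can be chosen such that: (a) if $0\to S_1^{\oplus k}\xrightarrow{\iota} E\xrightarrow{\pi} L_p\to 0$ is a short exact sequence of $R$-modules, $e\in E$ satisfies $\pi(e)=1$, and $p^*(y)\,e = \iota(g(y)f_1)$, then $\Theta_{p,k}$ sends the class of this extension to $g \bmod p^*$; (b) if $\alpha:S_1^{\oplus k}\to S_1^{\oplus l}$ is $R$-linear, $\alpha(g(y)f_1)=h(y)f_1$ and $\Theta_{p,k}(c)= g \bmod p^*$, then $\Theta_{p,l}(\alpha_*c)= h\bmod p^*$; (c) if $p,q$ are nonzero, $\beta:L_p\to L_q$ is $R$-linear with $\beta(1)=a(y)\cdot 1$, where $a,b\in K[T]$ satisfy $a\,p^* = b\,q^*$, and $\Theta_{q,k}(c)= g\bmod q^*$, then $\Theta_{p,k}(\beta^*c)= (b g_1,\dots,b g_k)\bmod p^*$. -/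

import Mathlib

open Polynomial CategoryTheory

universe u v w

noncomputable section

/-- The relation `x y = 1` on the free algebra on two letters; `x` is the letter `0` and `y` is the
letter `1`. -/
inductive JacobsonRel (K : Type u) [Field K] :
    FreeAlgebra K (Fin 2) → FreeAlgebra K (Fin 2) → Prop
  | xy : JacobsonRel K (FreeAlgebra.ι K 0 * FreeAlgebra.ι K 1) 1

/-- The Toeplitz-Jacobson algebra `R = K⟨x, y⟩ / (x y - 1)`. -/
def JacobsonAlgebra (K : Type u) [Field K] : Type u := RingQuot (JacobsonRel K)

namespace JacobsonAlgebra

variable (K : Type u) [Field K]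

instance : Ring (JacobsonAlgebra K) := inferInstanceAs (Ring (RingQuot (JacobsonRel K)))

instance : Algebra K (JacobsonAlgebra K) :=
  inferInstanceAs (Algebra K (RingQuot (JacobsonRel K)))

/-- The generator `x`. -/
def x : JacobsonAlgebra K := RingQuot.mkAlgHom K (JacobsonRel K) (FreeAlgebra.ι K 0)

/-- The generator `y`. -/
def y : JacobsonAlgebra K := RingQuot.mkAlgHom K (JacobsonRel K) (FreeAlgebra.ι K 1)

theorem x_mul_y : x K * y K = 1 := by
  have h := RingQuot.mkAlgHom_rel K (JacobsonRel.xy (K := K))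
  rw [map_mul, map_one] at h
  exact h

/-- The idempotent `f₁ = 1 - y x`. -/
def f₁ : JacobsonAlgebra K := 1 - y K * x K

/-- The simple left ideal `S₁ = R f₁`. -/
abbrev S₁ : Submodule (JacobsonAlgebra K) (JacobsonAlgebra K) :=
  Submodule.span (JacobsonAlgebra K) {f₁ K}

/-- The element `g(y) f₁` of `S₁`, for a polynomial `g`. -/
def polyS₁ (g : K[X]) : S₁ K :=
  ⟨aeval (y K) g * f₁ K, Submodule.smul_mem _ _ (Submodule.mem_span_singleton_self _)⟩

/-- The element `(g₁(y) f₁, …, g_k(y) f₁)` of `S₁^k`. -/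
def polyS₁Pow {k : ℕ} (g : Fin k → K[X]) : Fin k → S₁ K := fun i => polyS₁ K (g i)

/-- The quotient map from `R` to the Laurent polynomials, `x ↦ T` and `y ↦ T⁻¹`. -/
def toLaurent : JacobsonAlgebra K →ₐ[K] LaurentPolynomial K :=
  RingQuot.liftAlgHom K
    ⟨FreeAlgebra.lift K ![LaurentPolynomial.T 1, LaurentPolynomial.T (-1)], by
      rintro _ _ ⟨⟩
      rw [map_mul, map_one, FreeAlgebra.lift_ι_apply, FreeAlgebra.lift_ι_apply]
      exact (LaurentPolynomial.T_add 1 (-1)).symm.trans LaurentPolynomial.T_zero⟩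

@[simp]
theorem toLaurent_x : toLaurent K (x K) = LaurentPolynomial.T 1 := by
  rw [toLaurent, x]
  exact (RingQuot.liftAlgHom_mkAlgHom_apply _ _ _ _).trans (by simp)

@[simp]
theorem toLaurent_y : toLaurent K (y K) = LaurentPolynomial.T (-1) := by
  rw [toLaurent, y]
  exact (RingQuot.liftAlgHom_mkAlgHom_apply _ _ _ _).trans (by simp)

variable {K}

/-- `L_p = K[x, x⁻¹] / (p)`, for a polynomial `p` in `x`. -/
def L (p : K[X]) : Type u :=
  LaurentPolynomial K ⧸ Ideal.span {Polynomial.toLaurent p}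

instance (p : K[X]) : AddCommGroup (L p) :=
  inferInstanceAs (AddCommGroup (LaurentPolynomial K ⧸ Ideal.span {Polynomial.toLaurent p}))

/-- `L_p` is an `R`-module through the quotient map from `R` to `K[x, x⁻¹]`. -/
instance (p : K[X]) : Module (JacobsonAlgebra K) (L p) :=
  Module.compHom (LaurentPolynomial K ⧸ Ideal.span {Polynomial.toLaurent p})
    (toLaurent K).toRingHom

/-- The class of a Laurent polynomial in `L_p`. -/
def L.mk (p : K[X]) (g : LaurentPolynomial K) : L p := Ideal.Quotient.mk _ g

theorem L.smul_mk (p : K[X]) (r : JacobsonAlgebra K) (g : LaurentPolynomial K) :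
    r • L.mk p g = L.mk p (toLaurent K r * g) := rfl

/-- The reversed polynomial `p*`. -/
abbrev pStar (p : K[X]) : K[X] := p.reverse

/-- `p*` is characterised by `p*(y) = p(x) y ^ deg p` in `R`. -/
theorem aeval_pStar (p : K[X]) :
    aeval (y K) (pStar p) = aeval (x K) p * y K ^ p.natDegree := by
  have hxy : ∀ i : ℕ, x K ^ i * y K ^ i = 1 := by
    intro i
    induction i with
    | zero => simp
    | succ i ih =>
      rw [pow_succ, pow_succ', mul_assoc, ← mul_assoc (x K) (y K), x_mul_y, one_mul, ih]
  have hlt : (pStar p).natDegree < p.natDegree + 1 :=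
    Nat.lt_succ_of_le (reverse_natDegree_le p)
  rw [aeval_eq_sum_range' hlt, aeval_eq_sum_range, Finset.sum_mul,
    ← Finset.sum_range_reflect]
  refine Finset.sum_congr rfl fun i hi => ?_
  have hi' : i ≤ p.natDegree := Nat.lt_succ_iff.mp (Finset.mem_range.mp hi)
  have e1 : p.natDegree + 1 - 1 - i = p.natDegree - i := by omega
  have e2 : y K ^ p.natDegree = y K ^ i * y K ^ (p.natDegree - i) := by
    rw [← pow_add, Nat.add_sub_cancel' hi']
  rw [e1, coeff_reverse, revAt_le (Nat.sub_le _ _), Nat.sub_sub_self hi', smul_mul_assoc, e2,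
    ← mul_assoc, hxy, one_mul]

/-- `(K[T] / (p*(T)))^k`. -/
abbrev StarQuot (p : K[X]) (k : ℕ) : Type u := Fin k → K[X] ⧸ Ideal.span {pStar p}

/-- The class in `(K[T] / (p*(T)))^k` of a tuple of polynomials. -/
def StarQuot.mk (p : K[X]) {k : ℕ} (g : Fin k → K[X]) : StarQuot p k :=
  fun i => Ideal.Quotient.mk _ (g i)

variable (K) in
/-- `S₁^k` as an object of the category of left `R`-modules. -/
abbrev SObj (k : ℕ) : ModuleCat.{u} (JacobsonAlgebra K) :=
  ModuleCat.of (JacobsonAlgebra K) (Fin k → S₁ K)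

/-- `L_p` as an object of the category of left `R`-modules. -/
abbrev LObj (p : K[X]) : ModuleCat.{u} (JacobsonAlgebra K) :=
  ModuleCat.of (JacobsonAlgebra K) (L p)

end JacobsonAlgebra

end

noncomputable section

namespace JacobsonAlgebra

/-! ### Structure of `R`, its Laurent quotient and the simple module `S₁`. -/

section Algebra

variable (K : Type u) [Field K]

/-! Right multiplication by a high power of `y` moves any element of `R` into `K[y]`, where the map
to Laurent polynomials is injective (`exists_mul_y_pow`). So the kernel of `toLaurent` consists of
the elements killed on the right by some `y ^ N`. Since `p*` is coprime to `X ^ N`, Bézout shows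
that right multiplication by `p*(y)` is injective on `R` and that its image contains this kernel.
This yields the free resolution `0 → R → R → L_p → 0` (`resolution_shortExact`).

The ideal `S₁` is simple, and it is free of rank one over `K[y]` on `f₁`. Applying `Hom(-, S₁^k)` to
the resolution identifies `Ext¹` with `S₁^k / p*(y) S₁^k`, that is, with `(K[T]/(p*))^k`. The
explicit formulas come from morphisms of short exact sequences out of the resolution.

For a module `M` of finite length, `f₁ M` lies in the `S₁`-isotypic component. Modulo this component
`f₁` acts by zero, so `K[x, x⁻¹]` acts, and finite length over it forces finite dimension.
Conversely `f₁` kills every finite-dimensional module, because one-sided inverses of endomorphisms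
are two-sided there; the structure theorem over the principal ideal domain `K[x, x⁻¹]` then applies.
-/

variable {K} in
theorem induction {P : JacobsonAlgebra K → Prop} (r : JacobsonAlgebra K)
    (algebraMap : ∀ c : K, P (algebraMap K _ c)) (x : P (x K)) (y : P (y K))
    (add : ∀ r s, P r → P s → P (r + s)) (mul : ∀ r s, P r → P s → P (r * s)) : P r := by
  obtain ⟨a, rfl⟩ := RingQuot.mkAlgHom_surjective K (JacobsonRel K) r
  induction a using FreeAlgebra.induction with
  | grade0 c =>
    rw [AlgHom.commutes]
    exact algebraMap c
  | grade1 i =>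
    fin_cases i
    exacts [x, y]
  | mul a b ha hb =>
    rw [map_mul]
    exact mul _ _ ha hb
  | add a b ha hb =>
    rw [map_add]
    exact add _ _ ha hb

variable {K} in
/-- The algebra homomorphism determined by a pair `a, b` with `a * b = 1`. -/
def lift {A : Type*} [Semiring A] [Algebra K A] (a b : A) (h : a * b = 1) :
    JacobsonAlgebra K →ₐ[K] A :=
  RingQuot.liftAlgHom K ⟨FreeAlgebra.lift K ![a, b], by rintro _ _ ⟨⟩; simpa using h⟩

@[simp]
theorem lift_x {A : Type*} [Semiring A] [Algebra K A] (a b : A) (h : a * b = 1) :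
    lift a b h (x K) = a := by
  rw [lift, x]
  exact (RingQuot.liftAlgHom_mkAlgHom_apply _ _ _ _).trans (by simp)

@[simp]
theorem lift_y {A : Type*} [Semiring A] [Algebra K A] (a b : A) (h : a * b = 1) :
    lift a b h (y K) = b := by
  rw [lift, y]
  exact (RingQuot.liftAlgHom_mkAlgHom_apply _ _ _ _).trans (by simp)

@[simp]
theorem x_mul_f₁ : x K * f₁ K = 0 := by
  rw [f₁, mul_sub, ← mul_assoc, x_mul_y]
  simp

/-- Let `y` act on `K[X]` as multiplication by `X` and `x` as `divX`; then `f₁` fixes the constant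
`1`. -/
theorem f₁_ne_zero : f₁ K ≠ 0 := by
  let D : Module.End K K[X] :=
    { toFun := divX, map_add' := fun _ _ => divX_add, map_smul' := fun c p => by ext; simp }
  have h : D * LinearMap.mulLeft K X = 1 := by
    ext1 i
    ext1
    ext
    simp [D, coeff_divX, coeff_monomial]
  intro h0
  have := congrArg (fun r => lift D (LinearMap.mulLeft K X) h r (1 : K[X])) h0
  simp [f₁, D] at this

theorem f₁_mul_f₁ : f₁ K * f₁ K = f₁ K := by
  conv_lhs => enter [1]; rw [f₁]
  rw [sub_mul, mul_assoc, x_mul_f₁]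
  simp

/-- Right multiplication by a power of `y` moves any element into `K[y]`. -/
theorem exists_mul_y_pow (r : JacobsonAlgebra K) :
    ∃ (N : ℕ) (g : K[X]), r * y K ^ N = aeval (y K) g := by
  induction r using induction with
  | algebraMap c => exact ⟨0, C c, by simp⟩
  | x => exact ⟨1, 1, by simp [x_mul_y]⟩
  | y => exact ⟨0, X, by simp⟩
  | add r s hr hs =>
    obtain ⟨M, g, hg⟩ := hr
    obtain ⟨N, h, hh⟩ := hs
    refine ⟨M + N, g * X ^ N + h * X ^ M, ?_⟩
    rw [add_mul, pow_add, ← mul_assoc, hg, ← pow_add, add_comm M N, pow_add, ← mul_assoc, hh]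
    simp
  | mul r s hr hs =>
    obtain ⟨M, g, hg⟩ := hr
    obtain ⟨N, h, hh⟩ := hs
    refine ⟨N + M, g * h, ?_⟩
    rw [pow_add, mul_assoc, ← mul_assoc s, hh, map_mul, ← hg, mul_assoc r]
    congr 1
    rw [← aeval_X_pow (R := K) (y K), ← map_mul, ← map_mul, mul_comm]

theorem toLaurent_aeval_x (g : K[X]) : toLaurent K (aeval (x K) g) = Polynomial.toLaurent g := by
  rw [← aeval_algHom_apply, toLaurent_x, ← toLaurent_X, ← coe_toLaurentAlg, aeval_algHom_apply,
    aeval_X_left_apply]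

theorem toLaurent_aeval_y (g : K[X]) :
    toLaurent K (aeval (y K) g) = LaurentPolynomial.invert (Polynomial.toLaurent g) := by
  have : (LaurentPolynomial.T (-1) : LaurentPolynomial K) =
     ((LaurentPolynomial.invert (R := K)).toAlgHom.comp toLaurentAlg) X := by
    simp
  rw [← aeval_algHom_apply, toLaurent_y, this, aeval_algHom_apply, aeval_X_left_apply]
  rfl

theorem toLaurent_aeval_y_eq_zero {g : K[X]} : toLaurent K (aeval (y K) g) = 0 ↔ g = 0 := by
  rw [toLaurent_aeval_y, EmbeddingLike.map_eq_zero_iff, Polynomial.toLaurent_eq_zero]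

theorem toLaurent_surjective : Function.Surjective (toLaurent K) := by
  intro g
  obtain ⟨n, f, hf⟩ := LaurentPolynomial.exists_T_pow g
  refine ⟨aeval (x K) f * y K ^ n, ?_⟩
  rw [map_mul, toLaurent_aeval_x, hf, map_pow, toLaurent_y, LaurentPolynomial.T_pow, mul_assoc,
    ← LaurentPolynomial.T_add]
  simp

variable {K}

/-- The constant coefficient of `p*` is the leading coefficient of `p`, so `X` does not divide `p*`.
-/
theorem pStar_isCoprime_X_pow {p : K[X]} (hp : p ≠ 0) (N : ℕ) : IsCoprime (pStar p) (X ^ N) := by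
  refine IsCoprime.pow_right (IsCoprime.symm ?_)
  refine (irreducible_X.coprime_iff_not_dvd).2 ?_
  rw [X_dvd_iff]
  simpa using hp

/-- An element killed on the right by a power of `y` is a left multiple of `p*(y)`. -/
theorem exists_mul_pStar_of_mul_y_pow_eq_zero {p : K[X]} (hp : p ≠ 0) (N : ℕ) :
    ∃ u : K[X], ∀ r : JacobsonAlgebra K, r * y K ^ N = 0 →
      r = r * aeval (y K) u * aeval (y K) (pStar p) ∧
      r = r * aeval (y K) (pStar p) * aeval (y K) u := by
  -- In the Bézout identity `u p* + v X ^ N = 1`, evaluated at `y`, left multiplication by `r` kills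
  -- the second term.
  obtain ⟨u, v, h⟩ := pStar_isCoprime_X_pow hp N
  have h' := congrArg (aeval (y K)) h
  refine ⟨u, fun r hr => ?_⟩
  have : r = r * aeval (y K) u * aeval (y K) (pStar p) := by
    rw [map_add, map_one, mul_comm v, map_mul, map_mul, aeval_X_pow] at h'
    conv_lhs => rw [← mul_one r, ← h', mul_add, ← mul_assoc, ← mul_assoc, hr]
    simp
  refine ⟨this, this.trans ?_⟩
  rw [mul_assoc, mul_assoc, ← map_mul, ← map_mul, mul_comm]

/-- Multiplying by `y ^ N` reduces to a product in the domain `K[X]`, so `r y ^ N = 0`; Bézout then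
recovers `r` from `r p*(y) = 0`. -/
theorem mul_pStar_injective {p : K[X]} (hp : p ≠ 0) {r : JacobsonAlgebra K}
    (h : r * aeval (y K) (pStar p) = 0) : r = 0 := by
  obtain ⟨N, g, hg⟩ := exists_mul_y_pow K r
  have h0 : aeval (y K) g * aeval (y K) (pStar p) = 0 := by
    rw [← hg, mul_assoc, ← aeval_X_pow (R := K) (y K), ← map_mul, mul_comm (X ^ N), map_mul,
      ← mul_assoc, h, zero_mul]
  have h1 : g * pStar p = 0 := by
    rw [← toLaurent_aeval_y_eq_zero, map_mul, h0, map_zero]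
  have h2 : g = 0 := (mul_eq_zero.1 h1).resolve_right (by simpa using hp)
  obtain ⟨u, hu⟩ := exists_mul_pStar_of_mul_y_pow_eq_zero hp N
  rw [(hu r (by rw [hg, h2, map_zero])).2, h, zero_mul]

theorem exists_mul_pStar_of_toLaurent_eq_zero {p : K[X]} (hp : p ≠ 0) {r : JacobsonAlgebra K}
    (h : toLaurent K r = 0) : ∃ s, s * aeval (y K) (pStar p) = r := by
  obtain ⟨N, g, hg⟩ := exists_mul_y_pow K r
  have h2 : g = 0 := by
    rw [← toLaurent_aeval_y_eq_zero, ← hg, map_mul, h, zero_mul]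
  obtain ⟨u, hu⟩ := exists_mul_pStar_of_mul_y_pow_eq_zero hp N
  exact ⟨_, (hu r (by rw [hg, h2, map_zero])).1.symm⟩

theorem toLaurent_pStar (p : K[X]) : toLaurent K (aeval (y K) (pStar p)) =
    Polynomial.toLaurent p * LaurentPolynomial.T (-p.natDegree) := by
  rw [aeval_pStar, map_mul, toLaurent_aeval_x, map_pow, toLaurent_y, LaurentPolynomial.T_pow]
  simp

variable (K) in
/-- The kernel of the quotient map to Laurent polynomials annihilates every module on which `f₁`
acts by zero. -/
theorem smul_eq_zero_of_toLaurent_eq_zero {M : Type*} [AddCommGroup M] [Module (JacobsonAlgebra K) M]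
    (hM : ∀ m : M, f₁ K • m = 0) {r : JacobsonAlgebra K}
    (h : toLaurent K r = 0) (m : M) : r • m = 0 := by
  have hxy : ∀ m : M, y K • x K • m = m := fun m => by
    have := hM m
    rw [f₁, sub_smul, sub_eq_zero, one_smul, mul_smul] at this
    exact this.symm
  obtain ⟨N, g, hg⟩ := exists_mul_y_pow K r
  have h2 : g = 0 := by
    rw [← toLaurent_aeval_y_eq_zero, ← hg, map_mul, h, zero_mul]
  -- On `M` the element `y ^ N x ^ N` acts as the identity, so `r m = (r y ^ N) x ^ N m = 0`.
  have key : ∀ (N : ℕ) (m : M), y K ^ N • x K ^ N • m = m := by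
    intro N
    induction N with
    | zero => simp
    | succ N ih =>
      intro m
      rw [pow_succ, pow_succ', mul_smul, mul_smul, hxy, ih]
  rw [← key N m, ← mul_smul, hg, h2, map_zero, zero_smul]

theorem x_mul_aeval_y_mul_f₁ (g : K[X]) :
    x K * (aeval (y K) g * f₁ K) = aeval (y K) (divX g) * f₁ K := by
  conv_lhs => rw [← X_mul_divX_add g]
  simp only [map_add, map_mul, aeval_X, aeval_C, add_mul, mul_add]
  rw [← mul_assoc, ← mul_assoc, x_mul_y, ← mul_assoc, ← Algebra.commutes, mul_assoc _ (x K)]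
  simp

theorem exists_polyS₁ (s : S₁ K) : ∃ g, polyS₁ K g = s := by
  obtain ⟨s, hs⟩ := s
  obtain ⟨r, rfl⟩ := Submodule.mem_span_singleton.1 hs
  -- Stability of `K[y] f₁` under all of `R` is what the induction on `r` can prove.
  suffices h : ∀ g : K[X], ∃ h : K[X], r * (aeval (y K) g * f₁ K) = aeval (y K) h * f₁ K by
    obtain ⟨h, hh⟩ := h 1
    exact ⟨h, Subtype.ext (hh.symm.trans (by simp))⟩
  clear hs
  induction r using induction with
  | algebraMap c => exact fun g => ⟨C c * g, by simp [mul_assoc]⟩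
  | x => exact fun g => ⟨divX g, x_mul_aeval_y_mul_f₁ g⟩
  | y => exact fun g => ⟨X * g, by simp [mul_assoc]⟩
  | add r s hr hs =>
    intro g
    obtain ⟨a, ha⟩ := hr g
    obtain ⟨b, hb⟩ := hs g
    exact ⟨a + b, by rw [add_mul, ha, hb, map_add, add_mul]⟩
  | mul r s hr hs =>
    intro g
    obtain ⟨b, hb⟩ := hs g
    obtain ⟨a, ha⟩ := hr b
    exact ⟨a, by rw [mul_assoc, hb, ha]⟩

/-- A nonzero element `g(y) f₁` of `S₁` can be brought back to `f₁`. -/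
theorem exists_mul_aeval_y_mul_f₁ {g : K[X]} (hg : g ≠ 0) :
    ∃ r : JacobsonAlgebra K, r * (aeval (y K) g * f₁ K) = f₁ K := by
  induction hn : g.natDegree generalizing g with
  | zero =>
    obtain ⟨c, rfl⟩ := natDegree_eq_zero.1 hn
    refine ⟨algebraMap K _ c⁻¹, ?_⟩
    rw [aeval_C, ← mul_assoc, ← map_mul, inv_mul_cancel₀ (by simpa using hg)]
    simp
  | succ n ih =>
    have hd : (divX g).natDegree = n := by rw [natDegree_divX_eq_natDegree_tsub_one, hn]; rfl
    have h0 : divX g ≠ 0 := by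
      intro h
      have := X_mul_divX_add g
      rw [h, mul_zero, zero_add] at this
      rw [← this] at hn
      simp at hn
    obtain ⟨r, hr⟩ := ih h0 hd
    exact ⟨r * x K, by rw [mul_assoc, x_mul_aeval_y_mul_f₁, hr]⟩

theorem polyS₁_eq_zero {g : K[X]} (h : polyS₁ K g = 0) : g = 0 := by
  by_contra hg
  obtain ⟨r, hr⟩ := exists_mul_aeval_y_mul_f₁ hg
  rw [show aeval (y K) g * f₁ K = 0 from congrArg Subtype.val h, mul_zero] at hr
  exact f₁_ne_zero K hr.symm

theorem polyS₁_add (g h : K[X]) : polyS₁ K (g + h) = polyS₁ K g + polyS₁ K h :=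
  Subtype.ext (by simp [polyS₁, add_mul])

theorem polyS₁_injective : Function.Injective (polyS₁ K) := fun g h hgh => by
  rw [← sub_eq_zero]
  apply polyS₁_eq_zero
  rw [← add_left_inj (polyS₁ K h), ← polyS₁_add]
  simpa using hgh

theorem polyS₁_mul (g h : K[X]) : polyS₁ K (g * h) = aeval (y K) g • polyS₁ K h :=
  Subtype.ext (by simp [polyS₁, mul_assoc])

theorem polyS₁_C_mul (c : K) (h : K[X]) :
    polyS₁ K (C c * h) = algebraMap K (JacobsonAlgebra K) c • polyS₁ K h := by
  rw [polyS₁_mul, aeval_C]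

variable (K)

theorem f₁_smul_S₁ : ∃ s : S₁ K, s ≠ 0 ∧ f₁ K • s = s :=
  ⟨⟨f₁ K, Submodule.mem_span_singleton_self _⟩, fun h => f₁_ne_zero K (congrArg Subtype.val h),
    Subtype.ext (f₁_mul_f₁ K)⟩

instance isSimpleModule_S₁ : IsSimpleModule (JacobsonAlgebra K) (S₁ K) := by
  obtain ⟨s, hs, -⟩ := f₁_smul_S₁ K
  have : Nontrivial (S₁ K) := ⟨s, 0, hs⟩
  rw [isSimpleModule_iff_toSpanSingleton_surjective]
  refine ⟨this, fun m hm => ?_⟩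
  obtain ⟨g, rfl⟩ := exists_polyS₁ m
  have hg : g ≠ 0 := by
    rintro rfl
    exact hm (Subtype.ext (by simp [polyS₁]))
  obtain ⟨r, hr⟩ := exists_mul_aeval_y_mul_f₁ hg
  rintro ⟨t, ht⟩
  obtain ⟨a, rfl⟩ := Submodule.mem_span_singleton.1 ht
  refine ⟨a * r, Subtype.ext ?_⟩
  simp [polyS₁, mul_assoc, hr]

end Algebra
-- Modules of finite length.
section FiniteLength

variable (K : Type u) [Field K] {M : Type v} [AddCommGroup M] [Module (JacobsonAlgebra K) M]

variable {K} in
theorem y_smul_x_smul (hM : ∀ m : M, f₁ K • m = 0) (m : M) : y K • x K • m = m := by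
  have := hM m
  rw [f₁, sub_smul, sub_eq_zero, one_smul, mul_smul] at this
  exact this.symm

variable {K} in
/-- If `f₁` acts by zero on the cyclic module `R m` and `m` is annihilated by a nonzero polynomial
in `x`, then `R m` is finite-dimensional. -/
theorem finite_of_aeval_x_smul_eq_zero [Module K M] [IsScalarTower K (JacobsonAlgebra K) M]
    (hM : ∀ m : M, f₁ K • m = 0) (m : M)
    (hm : Function.Surjective (LinearMap.toSpanSingleton (JacobsonAlgebra K) M m))
    (g : K[X]) (hg : g ≠ 0) (hgm : aeval (x K) g • m = 0) : Module.Finite K M := by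
  let φ : K[X] →ₗ[K] M :=
    ((LinearMap.toSpanSingleton (JacobsonAlgebra K) M m).restrictScalars K).comp
      (aeval (x K)).toLinearMap
  have hφ : ∀ f, φ f = aeval (x K) f • m := fun _ => rfl
  have hle : (Ideal.span {g}).restrictScalars K ≤ LinearMap.ker φ := by
    intro f hf
    obtain ⟨h, rfl⟩ := Ideal.mem_span_singleton'.1 hf
    rw [LinearMap.mem_ker, hφ, map_mul, mul_smul, hgm, smul_zero]
  have : Module.Finite K (K[X] ⧸ (Ideal.span {g}).restrictScalars K) :=
    (AdjoinRoot.powerBasis hg).finite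
  have hfin : Module.Finite K (LinearMap.range φ) := by
    rw [← Submodule.range_liftQ _ φ hle]
    infer_instance
  have hx : ∀ w ∈ LinearMap.range φ, x K • w ∈ LinearMap.range φ := by
    rintro _ ⟨f, rfl⟩
    exact ⟨X * f, by rw [hφ, hφ, map_mul, mul_smul, aeval_X]⟩
  let ξ : Module.End K (LinearMap.range φ) := (Algebra.lsmul K K M (x K)).restrict hx
  have hξ : ∀ w, (ξ w : M) = x K • (w : M) := fun _ => rfl
  -- `y` inverts `x` on the left, so `x` is injective on the finite-dimensional space `K[x] m`,
  -- hence bijective; thus `y` preserves that space too.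
  have hinj : Function.Injective ξ := by
    intro a b hab
    have := congrArg (fun w : LinearMap.range φ => y K • (w : M)) hab
    simp only [hξ, y_smul_x_smul hM] at this
    exact Subtype.ext this
  have hsurj : Function.Surjective ξ := LinearMap.injective_iff_surjective.1 hinj
  have key : ∀ r : JacobsonAlgebra K, ∀ w ∈ LinearMap.range φ, r • w ∈ LinearMap.range φ := by
    intro r
    induction r using induction with
    | algebraMap c =>
      intro w hw
      rw [algebraMap_smul]
      exact Submodule.smul_mem _ _ hw
    | x => exact hx
    | y =>
      intro w hw
      obtain ⟨v, hv⟩ := hsurj ⟨w, hw⟩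
      have : w = x K • (v : M) := (congrArg Subtype.val hv).symm
      rw [this, y_smul_x_smul hM]
      exact v.2
    | add r s hr hs =>
      intro w hw
      rw [add_smul]
      exact add_mem (hr w hw) (hs w hw)
    | mul r s hr hs =>
      intro w hw
      rw [mul_smul]
      exact hr _ (hs w hw)
  have htop : LinearMap.range φ = ⊤ := by
    refine eq_top_iff.2 fun w _ => ?_
    obtain ⟨r, rfl⟩ := hm w
    exact key r m ⟨1, by simp [hφ]⟩
  rw [htop] at hfin
  exact Module.Finite.equiv Submodule.topEquiv

/-- If `(x - 1) m ≠ 0`, simplicity gives `m = r (x - 1) m`; clearing denominators turns this into a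
nonzero polynomial in `x` killing the generator `m`. -/
theorem finite_of_isSimpleModule [Module K M] [IsScalarTower K (JacobsonAlgebra K) M]
    [IsSimpleModule (JacobsonAlgebra K) M] (hM : ∀ m : M, f₁ K • m = 0) : Module.Finite K M := by
  have := IsSimpleModule.nontrivial (JacobsonAlgebra K) M
  obtain ⟨m, hm⟩ := exists_ne (0 : M)
  have hsurj := IsSimpleModule.toSpanSingleton_surjective (JacobsonAlgebra K) hm
  by_cases h1 : (x K - 1) • m = 0
  · exact finite_of_aeval_x_smul_eq_zero hM m hsurj (X - C 1) (X_sub_C_ne_zero 1) (by simpa using h1)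
  · obtain ⟨r, hr⟩ := IsSimpleModule.toSpanSingleton_surjective (JacobsonAlgebra K) h1 m
    rw [LinearMap.toSpanSingleton_apply] at hr
    obtain ⟨n, h, hh⟩ := LaurentPolynomial.exists_T_pow (toLaurent K r)
    have h0 : toLaurent K (x K ^ n * r - aeval (x K) h) = 0 := by
      rw [map_sub, map_mul, toLaurent_aeval_x, hh, map_pow, toLaurent_x, LaurentPolynomial.T_pow]
      rw [mul_one, LaurentPolynomial.T_mul, sub_self]
    have h2 := smul_eq_zero_of_toLaurent_eq_zero K hM h0 ((x K - 1) • m)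
    -- This polynomial takes the value `1` at `1`, so it is nonzero.
    refine finite_of_aeval_x_smul_eq_zero hM m hsurj (X ^ n - h * (X - 1)) ?_ ?_
    · intro h
      have := congrArg (eval 1) h
      simp at this
    · rw [sub_smul, mul_smul, hr, ← mul_smul, ← sub_smul] at h2
      simpa using h2

variable {K} in
theorem finite_of_isFiniteLength (h : IsFiniteLength (JacobsonAlgebra K) M) :
    ∀ [Module K M] [IsScalarTower K (JacobsonAlgebra K) M],
      (∀ m : M, f₁ K • m = 0) → Module.Finite K M := by
  induction h with
  | of_subsingleton =>
    intro _ _ _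
    infer_instance
  | @of_simple_quotient M _ _ N _ _ ih =>
    intro _ _ hM
    have : Module.Finite K N := ih fun m => Subtype.ext (hM m)
    have : Module.Finite K (M ⧸ N) := finite_of_isSimpleModule K fun m => by
      obtain ⟨m, rfl⟩ := N.mkQ_surjective m
      rw [← map_smul, hM, map_zero]
    have : Module.Finite K (N.restrictScalars K) := ‹Module.Finite K N›
    have : Module.Finite K (M ⧸ N.restrictScalars K) := ‹Module.Finite K (M ⧸ N)›
    exact Module.Finite.of_submodule_quotient (N.restrictScalars K)

/-- The map `S₁ → M`, `s ↦ s m`, sends `f₁` to `f₁ m`; as `S₁` is simple, it is zero or embeds `S₁`.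
-/
theorem f₁_smul_mem_isotypicComponent (m : M) :
    f₁ K • m ∈ isotypicComponent (JacobsonAlgebra K) M (S₁ K) := by
  let φ : S₁ K →ₗ[JacobsonAlgebra K] M :=
    (LinearMap.toSpanSingleton (JacobsonAlgebra K) M m).comp (S₁ K).subtype
  have hf : f₁ K • m = φ ⟨f₁ K, Submodule.mem_span_singleton_self _⟩ := rfl
  rcases LinearMap.injective_or_eq_zero φ with h | h
  · have hle : LinearMap.range φ ≤ isotypicComponent (JacobsonAlgebra K) M (S₁ K) :=
      le_sSup (show _ ∈ {m | _} from ⟨(LinearEquiv.ofInjective φ h).symm⟩)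
    exact hle ⟨_, hf.symm⟩
  · rw [hf, h]
    exact zero_mem _

theorem exists_exact_of_isFiniteLength (hM : IsFiniteLength (JacobsonAlgebra K) M) :
    ∃ (k : ℕ) (F : Type v) (_ : AddCommGroup F) (_ : Module (JacobsonAlgebra K) F)
      (_ : Module K F) (_ : IsScalarTower K (JacobsonAlgebra K) F)
      (ι : (Fin k → S₁ K) →ₗ[JacobsonAlgebra K] M) (π : M →ₗ[JacobsonAlgebra K] F),
      Function.Injective ι ∧ Function.Exact ι π ∧ Function.Surjective π ∧
        FiniteDimensional K F := by
  obtain ⟨_, _⟩ := isFiniteLength_iff_isNoetherian_isArtinian.1 hM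
  let N := isotypicComponent (JacobsonAlgebra K) M (S₁ K)
  obtain ⟨k, ⟨e⟩⟩ := (IsIsotypicOfType.isotypicComponent (JacobsonAlgebra K) M (S₁ K)).linearEquiv_fun
  let := Module.restrictScalars K (JacobsonAlgebra K) (M ⧸ N)
  have : IsScalarTower K (JacobsonAlgebra K) (M ⧸ N) := IsScalarTower.restrictScalars _ _ _
  refine ⟨k, M ⧸ N, inferInstance, inferInstance, inferInstance, inferInstance,
    N.subtype.comp e.symm.toLinearMap, N.mkQ, ?_, ?_, N.mkQ_surjective, ?_⟩
  · exact N.injective_subtype.comp e.symm.injective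
  · rw [LinearMap.exact_iff, Submodule.ker_mkQ, LinearMap.range_comp, LinearEquiv.range,
      Submodule.map_top, Submodule.range_subtype]
  · refine finite_of_isFiniteLength
      (isFiniteLength_iff_isNoetherian_isArtinian.2 ⟨inferInstance, inferInstance⟩) fun m => ?_
    obtain ⟨m, rfl⟩ := N.mkQ_surjective m
    rw [← map_smul, Submodule.mkQ_apply, Submodule.Quotient.mk_eq_zero]
    exact f₁_smul_mem_isotypicComponent K m

end FiniteLength

/-! ### Finite-dimensional modules. -/

section FiniteDimensional

variable (K : Type u) [Field K]

instance : IsPrincipalIdealRing (LaurentPolynomial K) where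
  principal I := by
    obtain ⟨g, hg⟩ := IsPrincipalIdealRing.principal (I.under K[X])
    refine ⟨algebraMap K[X] _ g, ?_⟩
    -- Every ideal of a localization is extended from its contraction, here to `K[X]`.
    rw [← IsLocalization.map_under (Submonoid.powers (X : K[X])) _ I, hg]
    exact (Ideal.map_span _ _).trans (by rw [Set.image_singleton])

variable {K}

theorem exists_span_toLaurent_eq {q : LaurentPolynomial K} (hq : q ≠ 0) :
    ∃ p : K[X], p ≠ 0 ∧ Ideal.span {q} = Ideal.span {Polynomial.toLaurent p} := by
  obtain ⟨n, p, hp⟩ := LaurentPolynomial.exists_T_pow q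
  refine ⟨p, ?_, ?_⟩
  · rintro rfl
    rw [map_zero, eq_comm, (LaurentPolynomial.isUnit_T _).mul_left_eq_zero] at hp
    exact hq hp
  · rw [hp, Ideal.span_singleton_mul_right_unit (LaurentPolynomial.isUnit_T _)]

variable {F : Type w} [AddCommGroup F] [Module (JacobsonAlgebra K) F]

/-- A module on which `f₁` acts by zero is a module over the Laurent polynomials. -/
theorem exists_laurentModule (hF : ∀ m : F, f₁ K • m = 0) :
    ∃ _ : Module (LaurentPolynomial K) F,
      ∀ (r : JacobsonAlgebra K) (m : F), toLaurent K r • m = r • m := by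
  let _ : SMul (LaurentPolynomial K) F :=
    ⟨fun a m => Function.surjInv (toLaurent_surjective K) a • m⟩
  have h : ∀ (r : JacobsonAlgebra K) (m : F), toLaurent K r • m = r • m := fun r m => by
    change Function.surjInv (toLaurent_surjective K) (toLaurent K r) • m = r • m
    rw [← sub_eq_zero, ← sub_smul]
    refine smul_eq_zero_of_toLaurent_eq_zero K hF ?_ m
    rw [map_sub, Function.surjInv_eq (toLaurent_surjective K), sub_self]
  exact ⟨Function.Surjective.moduleLeft (toLaurent K).toRingHom (toLaurent_surjective K) h, h⟩

variable [Module K F] [IsScalarTower K (JacobsonAlgebra K) F]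

theorem f₁_smul_eq_zero_of_finiteDimensional [FiniteDimensional K F] (m : F) : f₁ K • m = 0 := by
  have h : Algebra.lsmul K K F (x K) * Algebra.lsmul K K F (y K) = 1 := by
    rw [← map_mul, x_mul_y, map_one]
  rw [mul_eq_one_comm] at h
  have := LinearMap.congr_fun h m
  rw [f₁, sub_smul, one_smul, mul_smul, sub_eq_zero]
  exact this.symm

theorem exists_linearEquiv_pi_L [FiniteDimensional K F] :
    ∃ (n : ℕ) (p : Fin n → K[X]), (∀ i, p i ≠ 0) ∧
      Nonempty (F ≃ₗ[JacobsonAlgebra K] (∀ i, L (p i))) := by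
  classical
  obtain ⟨_, hsmul⟩ := exists_laurentModule (K := K) (F := F) f₁_smul_eq_zero_of_finiteDimensional
  have : IsScalarTower K (LaurentPolynomial K) F := ⟨fun c a m => by
    obtain ⟨r, rfl⟩ := toLaurent_surjective K a
    rw [← map_smul, hsmul, hsmul, smul_assoc]⟩
  have : Module.Finite (LaurentPolynomial K) F := Module.Finite.of_restrictScalars_finite K _ _
  have htors : Module.IsTorsion (LaurentPolynomial K) F := by
    -- Cayley–Hamilton: the characteristic polynomial of `x` kills `F`.
    let ξ : Module.End K F := Algebra.lsmul K K F (x K)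
    have hne : Polynomial.toLaurent ξ.charpoly ≠ 0 :=
      Polynomial.toLaurent_ne_zero.2 ξ.charpoly_monic.ne_zero
    intro m
    refine ⟨⟨Polynomial.toLaurent ξ.charpoly, mem_nonZeroDivisors_of_ne_zero hne⟩, ?_⟩
    change Polynomial.toLaurent ξ.charpoly • m = 0
    rw [← toLaurent_aeval_x, hsmul]
    have := LinearMap.congr_fun ξ.aeval_self_charpoly m
    rwa [aeval_algHom_apply] at this
  obtain ⟨ι, _, q, hq, e, ⟨E⟩⟩ := Module.equiv_directSum_of_isTorsion htors
  have hq' : ∀ i, q i ^ e i ≠ 0 := fun i => pow_ne_zero _ (hq i).ne_zero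
  choose p hp0 hp using fun i => exists_span_toLaurent_eq (hq' i)
  let σ := (Fintype.equivFin ι).symm
  refine ⟨Fintype.card ι, fun j => p (σ j), fun j => hp0 _, ⟨?_⟩⟩
  let E' : F ≃ₗ[LaurentPolynomial K]
      (∀ j, LaurentPolynomial K ⧸ Ideal.span {Polynomial.toLaurent (p (σ j))}) :=
    (E.trans (DirectSum.linearEquivFunOnFintype _ _ _)).trans <|
      (LinearEquiv.piCongrLeft (LaurentPolynomial K)
        (fun i => LaurentPolynomial K ⧸ Submodule.span (LaurentPolynomial K) {q i ^ e i}) σ).symm.trans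
        (LinearEquiv.piCongrRight fun j => Submodule.quotEquivOfEq _ _ (hp (σ j)))
  exact
    { toFun := E'
      map_add' := map_add E'
      map_smul' := fun r m => by
        rw [← hsmul, map_smul]
        rfl
      invFun := E'.symm
      left_inv := E'.left_inv
      right_inv := E'.right_inv }

end FiniteDimensional

/-! ### The free resolution of `L_p` and the computation of `Ext¹`. -/

section Ext

variable {K : Type u} [Field K]

variable (K) in
/-- `R` as an object of the category of left `R`-modules. -/
abbrev RObj : ModuleCat.{u} (JacobsonAlgebra K) :=
  ModuleCat.of (JacobsonAlgebra K) (JacobsonAlgebra K)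

/-- The morphism `R ⟶ M` sending `1` to `m`. -/
def eltHom {M : ModuleCat.{u} (JacobsonAlgebra K)} (m : M) : RObj K ⟶ M :=
  ModuleCat.ofHom (LinearMap.toSpanSingleton _ _ m)

@[simp]
theorem eltHom_apply {M : ModuleCat.{u} (JacobsonAlgebra K)} (m : M) (r : JacobsonAlgebra K) :
    (eltHom m).hom r = r • m := rfl

theorem eltHom_ext {M : ModuleCat.{u} (JacobsonAlgebra K)} {f g : RObj K ⟶ M}
    (h : f.hom (1 : JacobsonAlgebra K) = g.hom (1 : JacobsonAlgebra K)) : f = g :=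
  ModuleCat.hom_ext (LinearMap.ext_ring h)

theorem eltHom_hom_one {M : ModuleCat.{u} (JacobsonAlgebra K)} (f : RObj K ⟶ M) :
    eltHom (f.hom (1 : JacobsonAlgebra K)) = f :=
  eltHom_ext (one_smul _ _)

theorem eltHom_comp {M N : ModuleCat.{u} (JacobsonAlgebra K)} (m : M) (f : M ⟶ N) :
    eltHom m ≫ f = eltHom (f.hom m) :=
  eltHom_ext (by simp [eltHom])

theorem eltHom_add {M : ModuleCat.{u} (JacobsonAlgebra K)} (m n : M) :
    eltHom (m + n) = eltHom m + eltHom n :=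
  eltHom_ext (by
    rw [ModuleCat.hom_add, LinearMap.add_apply, eltHom_apply, eltHom_apply, eltHom_apply, smul_add])

theorem eltHom_algebraMap_smul {M : ModuleCat.{u} (JacobsonAlgebra K)} (c : K) (m : M) :
    eltHom (algebraMap K (JacobsonAlgebra K) c • m) = c • eltHom m :=
  eltHom_ext (by
    rw [eltHom_apply, one_smul]
    change _ = algebraMap K (JacobsonAlgebra K) c • (1 : JacobsonAlgebra K) • m
    rw [one_smul])

theorem L_mk_eq_zero {p : K[X]} {g : LaurentPolynomial K} :
    L.mk p g = 0 ↔ Polynomial.toLaurent p ∣ g :=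
  Ideal.Quotient.eq_zero_iff_dvd _ _

theorem L_mk_surjective (p : K[X]) : Function.Surjective (L.mk p) :=
  Ideal.Quotient.mk_surjective

theorem smul_L_mk_one (p : K[X]) (r : JacobsonAlgebra K) :
    r • L.mk p 1 = L.mk p (toLaurent K r) := by
  rw [L.smul_mk, mul_one]

theorem pStar_smul_L_mk_one (p : K[X]) : aeval (y K) (pStar p) • L.mk p 1 = 0 := by
  rw [smul_L_mk_one, L_mk_eq_zero, toLaurent_pStar]
  exact dvd_mul_right _ _

/-- The free resolution `0 → R → R → L_p → 0`, with first map the right multiplication by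
`p*(y)`. -/
abbrev resolution (p : K[X]) : ShortComplex (ModuleCat.{u} (JacobsonAlgebra K)) where
  X₁ := RObj K
  X₂ := RObj K
  X₃ := LObj p
  f := eltHom (M := RObj K) (aeval (y K) (pStar p))
  g := eltHom (M := LObj p) (L.mk p 1)
  zero := by
    rw [eltHom_comp]
    refine eltHom_ext ?_
    rw [eltHom_apply, one_smul, eltHom_apply]
    exact pStar_smul_L_mk_one p

theorem resolution_shortExact {p : K[X]} (hp : p ≠ 0) : (resolution p).ShortExact := by
  have hmono : Mono (resolution p).f := by
    rw [ModuleCat.mono_iff_injective]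
    exact (injective_iff_map_eq_zero (eltHom (M := RObj K) (aeval (y K) (pStar p))).hom).2
      fun r hr => mul_pStar_injective hp hr
  have hepi : Epi (resolution p).g := by
    rw [ModuleCat.epi_iff_surjective]
    intro l
    obtain ⟨g, rfl⟩ := L_mk_surjective p l
    obtain ⟨r, rfl⟩ := toLaurent_surjective K g
    exact ⟨r, smul_L_mk_one p r⟩
  refine ⟨?_⟩
  rw [ShortComplex.moduleCat_exact_iff]
  intro (r : JacobsonAlgebra K) hr
  have hr' : L.mk p (toLaurent K r) = 0 := (smul_L_mk_one p r).symm.trans hr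
  obtain ⟨g, hg⟩ := L_mk_eq_zero.1 hr'
  obtain ⟨s, rfl⟩ := toLaurent_surjective K g
  -- In Laurent polynomials `p` is `p*(y)` times the unit `x ^ deg p`, so `r` agrees with a left
  -- multiple of `p*(y)` up to the kernel, which itself consists of such multiples.
  have h0 : toLaurent K (r - s * x K ^ p.natDegree * aeval (y K) (pStar p)) = 0 := by
    rw [map_sub, map_mul, map_mul, toLaurent_pStar, hg, map_pow, toLaurent_x,
      LaurentPolynomial.T_pow, mul_one, mul_mul_mul_comm, mul_comm _ (Polynomial.toLaurent p),
      ← LaurentPolynomial.T_add]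
    simp
  obtain ⟨t, ht⟩ := exists_mul_pStar_of_toLaurent_eq_zero hp h0
  refine ⟨(t + s * x K ^ p.natDegree : JacobsonAlgebra K), ?_⟩
  change (t + s * x K ^ p.natDegree) * aeval (y K) (pStar p) = r
  rw [add_mul, ht]
  abel

/-- The class of the resolution of `L_p`. -/
def resolutionClass {p : K[X]} (hp : p ≠ 0) : Abelian.Ext (LObj p) (RObj K) 1 :=
  (resolution_shortExact hp).extClass

/-- The extension class attached to a tuple `g`, namely the pushout of the resolution of `L_p`
along the map `R → S₁^k` sending `1` to `g(y) f₁`. -/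
def extOfPoly {p : K[X]} (hp : p ≠ 0) {k : ℕ} (g : Fin k → K[X]) :
    Abelian.Ext (LObj p) (SObj K k) 1 :=
  (resolutionClass hp).comp
    (Abelian.Ext.mk₀ (eltHom (M := SObj K k) (polyS₁Pow K g))) (add_zero 1)

instance projective_RObj : Projective (RObj K) :=
  (IsProjective.iff_projective _).1 (inferInstance : Module.Projective (JacobsonAlgebra K) (JacobsonAlgebra K))

theorem exists_polyS₁Pow {k : ℕ} (s : Fin k → S₁ K) : ∃ g, polyS₁Pow K g = s := by
  choose g hg using fun i => exists_polyS₁ (s i)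
  exact ⟨g, funext hg⟩

/-- As `R` is projective, `Ext¹(R, -)` vanishes and the connecting map from `Hom(R, S₁^k)` is onto.
-/
theorem extOfPoly_surjective {p : K[X]} (hp : p ≠ 0) (k : ℕ) :
    Function.Surjective (extOfPoly hp (k := k)) := by
  intro c
  have : Projective (resolution p).X₂ := projective_RObj
  obtain ⟨c', hc'⟩ := Abelian.Ext.contravariant_sequence_exact₃ (resolution_shortExact hp) _ c
    (Abelian.Ext.eq_zero_of_projective _) (add_zero 1)
  obtain ⟨f, rfl⟩ := Abelian.Ext.addEquiv₀.symm.surjective c'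
  obtain ⟨g, hg⟩ := exists_polyS₁Pow (f.hom (1 : JacobsonAlgebra K))
  refine ⟨g, ?_⟩
  have hf : eltHom (M := SObj K k) (polyS₁Pow K g) = f := by
    rw [hg]
    exact eltHom_hom_one _
  rw [extOfPoly, hf]
  exact hc'

theorem polyS₁Pow_mul {k : ℕ} (a : K[X]) (g : Fin k → K[X]) :
    polyS₁Pow K (fun i => a * g i) = aeval (y K) a • polyS₁Pow K g :=
  funext fun i => polyS₁_mul a (g i)

theorem polyS₁Pow_injective {k : ℕ} : Function.Injective (polyS₁Pow K (k := k)) :=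
  fun _ _ h => funext fun i => polyS₁_injective (congrFun h i)

/-- The class vanishes exactly when `1 ↦ g(y) f₁` factors through right multiplication by `p*(y)`;
freeness of `S₁` over `K[y]` turns this into divisibility. -/
theorem extOfPoly_eq_zero {p : K[X]} (hp : p ≠ 0) {k : ℕ} {g : Fin k → K[X]} :
    extOfPoly hp g = 0 ↔ ∀ i, pStar p ∣ g i := by
  constructor
  · intro h
    obtain ⟨c, hc⟩ := Abelian.Ext.contravariant_sequence_exact₁ (resolution_shortExact hp) _ _
      (add_zero 1) h
    obtain ⟨f, rfl⟩ := Abelian.Ext.addEquiv₀.symm.surjective c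
    have hf : (resolution p).f ≫ f = eltHom (M := SObj K k) (polyS₁Pow K g) := by
      apply Abelian.Ext.addEquiv₀.symm.injective
      exact (Abelian.Ext.mk₀_comp_mk₀ _ _).symm.trans hc
    obtain ⟨h, hh⟩ := exists_polyS₁Pow (f.hom (1 : JacobsonAlgebra K))
    have hf' : polyS₁Pow K (fun i => pStar p * h i) = polyS₁Pow K g := by
      have h1 := congrArg (fun φ : RObj K ⟶ SObj K k => φ.hom (1 : JacobsonAlgebra K)) hf
      rw [polyS₁Pow_mul, hh]
      refine (Eq.trans ?_ h1).trans (one_smul _ _)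
      refine (f.hom.map_smul (aeval (y K) (pStar p)) (1 : JacobsonAlgebra K)).symm.trans ?_
      refine congrArg f.hom ?_
      exact (mul_one (aeval (y K) (pStar p))).trans (one_mul _).symm
    exact fun i => ⟨h i, (congrFun (polyS₁Pow_injective hf') i).symm⟩
  · intro h
    choose h hh using h
    have hg : g = fun i => pStar p * h i := funext hh
    have : eltHom (M := SObj K k) (polyS₁Pow K g) =
        eltHom (M := RObj K) (aeval (y K) (pStar p)) ≫
          eltHom (M := SObj K k) (polyS₁Pow K h) := by
      rw [hg, polyS₁Pow_mul, eltHom_comp, eltHom_apply]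
    rw [extOfPoly, this, ← Abelian.Ext.mk₀_comp_mk₀]
    exact (resolution_shortExact hp).extClass_comp_assoc _

/-- `extOfPoly` as a `K`-linear map. -/
def extOfPolyLinear {p : K[X]} (hp : p ≠ 0) (k : ℕ) :
    (Fin k → K[X]) →ₗ[K] Abelian.Ext (LObj p) (SObj K k) 1 where
  toFun := extOfPoly hp
  map_add' g h := by
    have hgh : polyS₁Pow K (g + h) = polyS₁Pow K g + polyS₁Pow K h :=
      funext fun i => polyS₁_add (g i) (h i)
    rw [extOfPoly, extOfPoly, extOfPoly, ← Abelian.Ext.comp_add, ← Abelian.Ext.mk₀_add,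
      ← eltHom_add, hgh]
  map_smul' c g := by
    have hg : polyS₁Pow K (c • g) = algebraMap K (JacobsonAlgebra K) c • polyS₁Pow K g := by
      refine funext fun i => ?_
      refine Eq.trans ?_ (polyS₁_C_mul c (g i))
      rw [← smul_eq_C_mul]
      rfl
    rw [extOfPoly, extOfPoly, RingHom.id_apply, ← Abelian.Ext.comp_smul, ← Abelian.Ext.mk₀_smul,
      ← eltHom_algebraMap_smul, hg]

/-- `StarQuot.mk` as a `K`-linear map. -/
def starQuotMkLinear (p : K[X]) (k : ℕ) : (Fin k → K[X]) →ₗ[K] StarQuot p k :=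
  LinearMap.pi fun i => (Ideal.Quotient.mkₐ K _).toLinearMap.comp (LinearMap.proj i)

theorem starQuotMkLinear_apply (p : K[X]) {k : ℕ} (g : Fin k → K[X]) :
    starQuotMkLinear p k g = StarQuot.mk p g := rfl

theorem starQuotMkLinear_surjective (p : K[X]) (k : ℕ) :
    Function.Surjective (starQuotMkLinear p k) := by
  intro q
  choose g hg using fun i => Ideal.Quotient.mk_surjective (q i)
  exact ⟨g, funext hg⟩

theorem ker_extOfPolyLinear {p : K[X]} (hp : p ≠ 0) (k : ℕ) :
    LinearMap.ker (extOfPolyLinear hp k) = LinearMap.ker (starQuotMkLinear p k) := by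
  ext g
  rw [LinearMap.mem_ker, LinearMap.mem_ker, starQuotMkLinear_apply]
  refine (extOfPoly_eq_zero hp).trans ?_
  rw [funext_iff]
  exact forall_congr' fun i => (Ideal.Quotient.eq_zero_iff_dvd _ _).symm

/-- The identification of `Ext¹(L_p, S₁^k)` with `(K[T] / (p*(T)))^k`. -/
def extEquiv (p : K[X]) (hp : p ≠ 0) (k : ℕ) :
    Abelian.Ext (LObj p) (SObj K k) 1 ≃ₗ[K] StarQuot p k :=
  ((extOfPolyLinear hp k).quotKerEquivOfSurjective (extOfPoly_surjective hp k)).symm.trans <|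
    (Submodule.quotEquivOfEq _ _ (ker_extOfPolyLinear hp k)).trans <|
      (starQuotMkLinear p k).quotKerEquivOfSurjective (starQuotMkLinear_surjective p k)

theorem extEquiv_extOfPoly {p : K[X]} (hp : p ≠ 0) {k : ℕ} (g : Fin k → K[X]) :
    extEquiv p hp k (extOfPoly hp g) = StarQuot.mk p g := by
  have : ((extOfPolyLinear hp k).quotKerEquivOfSurjective (extOfPoly_surjective hp k)).symm
      (extOfPoly hp g) = Submodule.Quotient.mk g :=
    (LinearEquiv.symm_apply_eq _).2 rfl
  rw [extEquiv, LinearEquiv.trans_apply, this]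
  rfl

/-- Reduces each property of the isomorphism to an identity between extension classes. -/
theorem extEquiv_eq_iff {p : K[X]} (hp : p ≠ 0) {k : ℕ} {g : Fin k → K[X]}
    {c : Abelian.Ext (LObj p) (SObj K k) 1} :
    extEquiv p hp k c = StarQuot.mk p g ↔ c = extOfPoly hp g := by
  rw [← extEquiv_extOfPoly hp, EmbeddingLike.apply_eq_iff_eq]

/-- Sending `1` to `e` lifts the identity of `L_p` to a map from the resolution to the extension,
with `1 ↦ g(y) f₁` on the kernels. -/
theorem extClass_eq_extOfPoly {p : K[X]} (hp : p ≠ 0) {k : ℕ} {E : ModuleCat.{u} (JacobsonAlgebra K)}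
    {ι : SObj K k ⟶ E} {π : E ⟶ LObj p} {hιπ : ι ≫ π = 0}
    (hE : (ShortComplex.mk ι π hιπ).ShortExact) {e : E} {g : Fin k → K[X]}
    (he : π.hom e = L.mk p 1)
    (hg : ι.hom (polyS₁Pow K g) = aeval (y K) (pStar p) • e) :
    hE.extClass = extOfPoly hp g := by
  let φ : resolution p ⟶ ShortComplex.mk ι π hιπ :=
    { τ₁ := eltHom (M := SObj K k) (polyS₁Pow K g)
      τ₂ := eltHom e
      τ₃ := 𝟙 _
      comm₁₂ := by
        refine (eltHom_comp (M := SObj K k) _ _).trans (Eq.trans ?_ (eltHom_comp (M := RObj K) _ _).symm)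
        exact congrArg eltHom hg
      comm₂₃ := by
        refine (eltHom_comp _ _).trans (Eq.trans ?_ (Category.comp_id _).symm)
        exact congrArg (eltHom (M := LObj p)) he }
  refine Eq.trans ?_ (ShortComplex.ShortExact.extClass_naturality (resolution_shortExact hp) hE φ).symm
  exact (Abelian.Ext.mk₀_id_comp _).symm

theorem extOfPoly_comp {p : K[X]} (hp : p ≠ 0) {k l : ℕ} {α : SObj K k ⟶ SObj K l}
    {g : Fin k → K[X]} {h : Fin l → K[X]} (hα : α.hom (polyS₁Pow K g) = polyS₁Pow K h) :
    (extOfPoly hp g).comp (Abelian.Ext.mk₀ α) (add_zero 1) = extOfPoly hp h := by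
  rw [extOfPoly, Abelian.Ext.comp_assoc_of_third_deg_zero, Abelian.Ext.mk₀_comp_mk₀, eltHom_comp, hα]
  rfl

/-- Right multiplications by `b(y)` and `a(y)` lift `β` to the resolutions; `a p* = b q*` is
commutativity of the left square. -/
theorem comp_extOfPoly {p q : K[X]} (hp : p ≠ 0) (hq : q ≠ 0) {k : ℕ} {β : LObj p ⟶ LObj q}
    {a b : K[X]} {g : Fin k → K[X]}
    (hβ : β.hom (L.mk p 1) = aeval (y K) a • L.mk q 1) (hab : a * pStar p = b * pStar q) :
    (Abelian.Ext.mk₀ β).comp (extOfPoly hq g) (zero_add 1) = extOfPoly hp fun i => b * g i := by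
  let φ : resolution p ⟶ resolution q :=
    { τ₁ := eltHom (M := RObj K) (aeval (y K) b)
      τ₂ := eltHom (M := RObj K) (aeval (y K) a)
      τ₃ := β
      comm₁₂ := by
        refine (eltHom_comp (M := RObj K) _ _).trans
          (Eq.trans ?_ (eltHom_comp (M := RObj K) _ _).symm)
        refine congrArg (eltHom (M := RObj K)) ?_
        change aeval (y K) b * aeval (y K) (pStar q) = aeval (y K) (pStar p) * aeval (y K) a
        rw [← map_mul, ← map_mul, ← hab, mul_comm]
      comm₂₃ := by
        refine (eltHom_comp (M := RObj K) _ _).trans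
          (Eq.trans ?_ (eltHom_comp (M := LObj p) _ _).symm)
        exact congrArg (eltHom (M := LObj q)) hβ.symm }
  have : (resolutionClass hp).comp (Abelian.Ext.mk₀ (eltHom (M := RObj K) (aeval (y K) b)))
      (add_zero 1) = (Abelian.Ext.mk₀ β).comp (resolutionClass hq) (zero_add 1) :=
    ShortComplex.ShortExact.extClass_naturality (resolution_shortExact hp)
      (resolution_shortExact hq) φ
  rw [extOfPoly, extOfPoly, ← Abelian.Ext.comp_assoc (a₁₂ := 1) _ _ _ (by lia) (by lia) (by lia),
    ← this, Abelian.Ext.comp_assoc_of_third_deg_zero, Abelian.Ext.mk₀_comp_mk₀, eltHom_comp,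
    eltHom_apply, polyS₁Pow_mul]

end Ext

end JacobsonAlgebra

end

theorem theorem4 (K : Type u) [Field K] :
    -- finite-length modules are extensions of finite-dimensional ones by powers of `S₁`
    (∀ (M : Type v) [AddCommGroup M] [Module (JacobsonAlgebra K) M],
      IsFiniteLength (JacobsonAlgebra K) M →
      ∃ (k : ℕ) (F : Type v) (_ : AddCommGroup F) (_ : Module (JacobsonAlgebra K) F)
        (_ : Module K F) (_ : IsScalarTower K (JacobsonAlgebra K) F)
        (ι : (Fin k → JacobsonAlgebra.S₁ K) →ₗ[JacobsonAlgebra K] M)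
        (π : M →ₗ[JacobsonAlgebra K] F),
        Function.Injective ι ∧ Function.Exact ι π ∧ Function.Surjective π ∧
          FiniteDimensional K F) ∧
    -- finite-dimensional modules are direct sums of modules `L_p`
    (∀ (F : Type w) [AddCommGroup F] [Module (JacobsonAlgebra K) F] [Module K F]
      [IsScalarTower K (JacobsonAlgebra K) F] [FiniteDimensional K F],
      ∃ (n : ℕ) (p : Fin n → K[X]), (∀ i, p i ≠ 0) ∧
        Nonempty (F ≃ₗ[JacobsonAlgebra K] (∀ i, JacobsonAlgebra.L (p i)))) ∧
    -- the natural identification of the Ext spaces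
    ∃ Θ : ∀ (p : K[X]), p ≠ 0 → ∀ k : ℕ,
        Abelian.Ext (JacobsonAlgebra.LObj p) (JacobsonAlgebra.SObj K k) 1 ≃ₗ[K]
          JacobsonAlgebra.StarQuot p k,
      -- value on the class of an extension `0 → S₁^k → E → L_p → 0`
      (∀ (p : K[X]) (hp : p ≠ 0) (k : ℕ) (E : ModuleCat.{u} (JacobsonAlgebra K))
        (ι : JacobsonAlgebra.SObj K k ⟶ E) (π : E ⟶ JacobsonAlgebra.LObj p)
        (hιπ : ι ≫ π = 0) (hE : (ShortComplex.mk ι π hιπ).ShortExact)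
        (e : E) (g : Fin k → K[X]),
        π.hom e = JacobsonAlgebra.L.mk p 1 →
        ι.hom (JacobsonAlgebra.polyS₁Pow K g) =
          aeval (JacobsonAlgebra.y K) (JacobsonAlgebra.pStar p) • e →
        Θ p hp k hE.extClass = JacobsonAlgebra.StarQuot.mk p g) ∧
      -- naturality in `S₁^k`
      (∀ (p : K[X]) (hp : p ≠ 0) (k l : ℕ)
        (α : JacobsonAlgebra.SObj K k ⟶ JacobsonAlgebra.SObj K l)
        (c : Abelian.Ext (JacobsonAlgebra.LObj p) (JacobsonAlgebra.SObj K k) 1)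
        (g : Fin k → K[X]) (h : Fin l → K[X]),
        α.hom (JacobsonAlgebra.polyS₁Pow K g) = JacobsonAlgebra.polyS₁Pow K h →
        Θ p hp k c = JacobsonAlgebra.StarQuot.mk p g →
        Θ p hp l (c.comp (Abelian.Ext.mk₀ α) (add_zero 1)) = JacobsonAlgebra.StarQuot.mk p h) ∧
      -- naturality in `L_p`
      (∀ (p q : K[X]) (hp : p ≠ 0) (hq : q ≠ 0) (k : ℕ)
        (β : JacobsonAlgebra.LObj p ⟶ JacobsonAlgebra.LObj q)
        (c : Abelian.Ext (JacobsonAlgebra.LObj q) (JacobsonAlgebra.SObj K k) 1)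
        (a b : K[X]) (g : Fin k → K[X]),
        β.hom (JacobsonAlgebra.L.mk p 1) =
          aeval (JacobsonAlgebra.y K) a • JacobsonAlgebra.L.mk q 1 →
        a * JacobsonAlgebra.pStar p = b * JacobsonAlgebra.pStar q →
        Θ q hq k c = JacobsonAlgebra.StarQuot.mk q g →
        Θ p hp k ((Abelian.Ext.mk₀ β).comp c (zero_add 1)) =
          JacobsonAlgebra.StarQuot.mk p (fun i => b * g i)) := by
  refine ⟨fun M _ _ hM => JacobsonAlgebra.exists_exact_of_isFiniteLength K hM,
    fun F _ _ _ _ _ => JacobsonAlgebra.exists_linearEquiv_pi_L,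
    JacobsonAlgebra.extEquiv, ?_, ?_, ?_⟩
  · intro p hp k E ι π hιπ hE e g he hg
    rw [JacobsonAlgebra.extEquiv_eq_iff]
    exact JacobsonAlgebra.extClass_eq_extOfPoly hp hE he hg
  · intro p hp k l α c g h hα hc
    rw [JacobsonAlgebra.extEquiv_eq_iff] at hc ⊢
    rw [hc, JacobsonAlgebra.extOfPoly_comp hp hα]
  · intro p q hp hq k β c a b g hβ hab hc
    rw [JacobsonAlgebra.extEquiv_eq_iff] at hc ⊢
    rw [hc, JacobsonAlgebra.comp_extOfPoly hp hq hβ hab]
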